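/- **Theorem 3.1.** Let $(\Omega,\mathcal F,\mathsf P)$ be a probability space. A *monotone family of Brownian motions* is a family of real random variables $(X(u,t))_{u\in\mathbb R,\,t\ge 0}$ on $\Omega$ such that for each $u$ the process $X(u,\cdot)-u$ is a standard Brownian motion started at $0$ with almost surely continuous paths, and such that, almost surely, for all $t\ge 0$ the map $u\mapsto X(u,t)$ is nondecreasing. Such a family is (the point motion of) a *Harris flow* with covariation function $\varphi:\mathbb R\to\mathbb R$ if, in addition, there is a filtration $(\mathcal F_t)_{t\ge0}$ such that every $X(u,\cdot)$ is an $(\mathcal F_t)$-Brownian motion (it is adapted and $X(u,t)-X(u,s)$ is independent of $\mathcal F_s$ for $s\le t$), $\varphi$ is positive definite (all matrices $(\varphi(x_i-x_j))_{i,j}$ are positive semidefinite) and has no nonzero period, and for all $u,v\in\mathbb R$, almost surely, for all $t\ge 0$, $$\langle X(u,\cdot),X(v,\cdot)\rangle_t=\int_0^t\varphi\bigl(X(u,s)-X(v,s)\bigr)\,ds .$$ Here the integrand is assumed to be integrable on $[0,t]$, and $\langle\cdot,\cdot\rangle$ denotes quadratic covariation with respect to $(\mathcal F_t)$. Then: 1.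 for every monotone family $X$ of Brownian motions, almost surely, $$\limsup_{t\downarrow 0}\ \sup_{u\in[0,1]}\frac{|X(u,t)-u|}{\sqrt{t\ln t^{-1}}}\le 1;$$ 2. in particular, the same holds for every Harris flow $X$ with $\varphi(0)=1$. -/

import Mathlib

open MeasureTheory ProbabilityTheory Filter Topology
open scoped NNReal ENNReal

/-- A monotone family of Brownian motions, indexed by the starting point `u`: every `X u` is a
Brownian motion started at `u` (that is, `X u - u` is a standard Brownian motion with almost
surely continuous paths), and almost surely all the maps `u ↦ X u t` are nondecreasing.
No assumption is made on the joint law of the Brownian motions beyond monotonicity. -/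
structure IsMonotoneBrownianFamily {Ω : Type*} [MeasurableSpace Ω]
    (X : ℝ → ℝ≥0 → Ω → ℝ) (P : Measure Ω) : Prop where
  brownian : ∀ u : ℝ, IsBrownianReal (fun t ω => X u t ω - u) P
  monotone : ∀ᵐ ω ∂P, ∀ t : ℝ≥0, Monotone (fun u : ℝ => X u t ω)

/-- `A` is the quadratic covariation `⟨M, N⟩` of the continuous local martingales `M` and `N`
with respect to the filtration `𝓕`: it is adapted, starts at `0`, has continuous paths of locally
bounded variation, and `M N - A` is a local martingale. -/
structure IsQuadraticCovariation {Ω : Type*} {mΩ : MeasurableSpace Ω}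
    (M N A : ℝ≥0 → Ω → ℝ) (𝓕 : Filtration ℝ≥0 mΩ) (P : Measure Ω) : Prop where
  adapted : Adapted 𝓕 A
  zero : ∀ᵐ ω ∂P, A 0 ω = 0
  continuous : ∀ᵐ ω ∂P, Continuous (fun t => A t ω)
  boundedVariation : ∀ᵐ ω ∂P, LocallyBoundedVariationOn (fun t => A t ω) Set.univ
  localMartingale :
    Locally (fun Z => Martingale Z 𝓕 P) 𝓕 (fun t ω => M t ω * N t ω - A t ω) P

/-- A real function on the line is positive definite: all the matrices `(φ (xᵢ - xⱼ))ᵢⱼ` are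
(symmetric and) positive semidefinite. -/
def IsPositiveDefiniteFunction (φ : ℝ → ℝ) : Prop :=
  ∀ (n : ℕ) (x : Fin n → ℝ), (Matrix.of fun i j => φ (x i - x j)).PosSemidef

/-- `X` is the point motion of a Harris flow with infinitesimal covariation function `φ`, with
respect to the filtration `𝓕`: it is a monotone family of `𝓕`-Brownian motions, `X u` starting
at `u`, with `d⟨X u, X v⟩ = φ (X u - X v) dt`, where `φ` is positive definite and aperiodic. -/
structure IsHarrisFlow {Ω : Type*} {mΩ : MeasurableSpace Ω} (φ : ℝ → ℝ)
    (X : ℝ → ℝ≥0 → Ω → ℝ) (𝓕 : Filtration ℝ≥0 mΩ) (P : Measure Ω) : Prop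
    extends IsMonotoneBrownianFamily X P where
  positiveDefinite : IsPositiveDefiniteFunction φ
  aperiodic : ∀ p : ℝ, p ≠ 0 → ¬ Function.Periodic φ p
  adapted : ∀ u : ℝ, Adapted 𝓕 (X u)
  indepIncrement : ∀ (u : ℝ) (s t : ℝ≥0), s ≤ t →
    Indep (MeasurableSpace.comap (fun ω => X u t ω - X u s ω) inferInstance) (𝓕 s) P
  covariation : ∀ u v : ℝ, ∃ A : ℝ≥0 → Ω → ℝ,
    IsQuadraticCovariation (X u) (X v) A 𝓕 P ∧
    ∀ᵐ ω ∂P, ∀ t : ℝ≥0,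
      IntervalIntegrable (fun s : ℝ => φ (X u s.toNNReal ω - X v s.toNNReal ω)) volume 0 t ∧
      A t ω = ∫ s in (0 : ℝ)..t, φ (X u s.toNNReal ω - X v s.toNNReal ω)

/-- The supremum over `u ∈ [0,1]` of `|X(u,t) - u| / √(t ln t⁻¹)`, as an extended nonnegative
real, so that an infinite supremum is `∞`. (The normalization is positive for `0 < t < 1`.) -/
noncomputable def normalizedSupDeviation {Ω : Type*} (X : ℝ → ℝ≥0 → Ω → ℝ) (t : ℝ≥0) (ω : Ω) :
    ℝ≥0∞ :=
  ⨆ u ∈ Set.Icc (0 : ℝ) 1,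
    ENNReal.ofReal (|X u t ω - u| / Real.sqrt ((t : ℝ) * Real.log (t : ℝ)⁻¹))

/-!
For a single Brownian motion `B`, Doob's inequality applied to the submartingale `exp (l B)` along
finer and finer dyadic grids gives, by path continuity, the maximal inequality
`P (∃ s ≤ T, a < |B s|) ≤ 2 exp (-a² / (2 T))`, with the sharp Gaussian exponent
(`ProbabilityTheory.IsBrownianReal.measure_exists_lt_abs_le`).

At the level `a = c √(T log T⁻¹)` this bound is `2 T ^ (c² / 2)`. Since only finitely many starting
points can be handled, `[0, 1]` is covered by a mesh of size `√T`, which has about `T ^ (-1/2)`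
points; monotonicity in the starting point controls all the other ones at the price of the mesh
size (`Monotone.abs_sub_le_of_mesh`), which is negligible with respect to `a`. The union bound is
therefore of order `T ^ ((c² - 1) / 2)`, no matter what the joint law of the Brownian motions is.
It is summable along a geometric sequence of times as soon as `c > 1`, so Borel–Cantelli applies
(`IsMonotoneBrownianFamily.ae_eventually_forall_mesh_le`). Taking the ratio of the sequence equal
to `c⁻²` and interpolating between consecutive times bounds the upper limit by `c ^ 3`
(`IsMonotoneBrownianFamily.ae_limsup_le_pow_three`), and `c` decreases to `1`.

The second claim is the special case of Harris flows, which are monotone families of Brownian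
motions by definition.
-/

/-! ### The maximal inequality for Brownian motion -/

section Maximal

variable {Ω : Type*} {mΩ : MeasurableSpace Ω} {P : Measure Ω} {B : ℝ≥0 → Ω → ℝ}

lemma ProbabilityTheory.IsPreBrownianReal.integrable_exp_mul (hB : IsPreBrownianReal B P)
    (l : ℝ) (t : ℝ≥0) :
    Integrable (fun ω => Real.exp (l * B t ω)) P := by
  have h := hB.hasLaw_eval t
  have h2 := integrable_exp_mul_gaussianReal (μ := 0) (v := t) l
  rw [← h.map_eq] at h2
  exact h2.comp_aemeasurable h.aemeasurable

lemma ProbabilityTheory.IsPreBrownianReal.integral_exp_mul (hB : IsPreBrownianReal B P)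
    (l : ℝ) (t : ℝ≥0) :
    ∫ ω, Real.exp (l * B t ω) ∂P = Real.exp (t * l ^ 2 / 2) := by
  have h := mgf_gaussianReal (hB.hasLaw_eval t).map_eq l
  simpa [mgf] using h

/-- The filtration generated by the path of `B` and sampled at the multiples of `δ`. -/
def gridFiltration (hB : ∀ t, Measurable (B t)) (δ : ℝ≥0) : Filtration ℕ mΩ where
  seq k := MeasurableSpace.comap (fun ω (t : Set.Iic (k * δ)) => B t ω) inferInstance
  mono' i j hij := by
    have hle : (i : ℝ≥0) * δ ≤ j * δ := by gcongr
    have hm : Measurable fun (x : Set.Iic ((j : ℝ≥0) * δ) → ℝ) (t : Set.Iic ((i : ℝ≥0) * δ)) =>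
        x ⟨t.1, t.2.trans hle⟩ := by fun_prop
    change MeasurableSpace.comap _ _ ≤ MeasurableSpace.comap _ _
    rintro _ ⟨s, hs, rfl⟩
    exact ⟨_, hm hs, rfl⟩
  le' k := (measurable_pi_lambda (fun ω (t : Set.Iic ((k : ℝ≥0) * δ)) => B t ω)
    fun t => hB t).comap_le

/-- The exponential of a Brownian motion is a submartingale: conditionally on the past, the
factor contributed by an increment has expectation `exp (δ l² / 2) ≥ 1`. -/
lemma ProbabilityTheory.IsPreBrownianReal.submartingale_exp_mul [IsProbabilityMeasure P]
    (hB : IsPreBrownianReal B P) (hm : ∀ t, Measurable (B t)) (l : ℝ) (δ : ℝ≥0) :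
    Submartingale (fun (k : ℕ) ω => Real.exp (l * B (k * δ) ω)) (gridFiltration hm δ) P := by
  have hadp : ∀ k : ℕ, StronglyMeasurable[gridFiltration hm δ k]
      (fun ω => Real.exp (l * B (k * δ) ω)) := fun k => by
    have h : Measurable[gridFiltration hm δ k] (B (k * δ)) :=
      (measurable_pi_apply (⟨k * δ, Set.self_mem_Iic⟩ : Set.Iic ((k : ℝ≥0) * δ))).comp
        (comap_measurable fun ω (t : Set.Iic ((k : ℝ≥0) * δ)) => B t ω)
    exact (Real.measurable_exp.comp (h.const_mul l)).stronglyMeasurable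
  refine submartingale_nat hadp (fun k => hB.integrable_exp_mul l _) fun k => ?_
  let D : Ω → ℝ := fun ω => B (k * δ + δ) ω - B (k * δ) ω
  have hDm : Measurable D := (hm _).sub (hm _)
  have hDint : Integrable (fun ω => Real.exp (l * D ω)) P :=
    (hB.shift (k * δ)).integrable_exp_mul l δ
  have hDval : ∫ ω, Real.exp (l * D ω) ∂P = Real.exp (δ * l ^ 2 / 2) :=
    (hB.shift (k * δ)).integral_exp_mul l δ
  have hind : Indep (MeasurableSpace.comap D inferInstance) (gridFiltration hm δ k) P := by
    have h := (hB.indepFun_shift (k * δ)).comp (φ := fun x : ℝ≥0 → ℝ => x δ) (ψ := id)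
      (measurable_pi_apply (X := fun _ => ℝ) δ) measurable_id
    exact (IndepFun_iff_Indep _ _ _).1 h
  have hcond : P[fun ω => Real.exp (l * D ω) | gridFiltration hm δ k]
      =ᵐ[P] fun _ => Real.exp (δ * l ^ 2 / 2) := by
    rw [← hDval]
    exact condExp_indep_eq hDm.comap_le ((gridFiltration hm δ).le k)
      (Real.measurable_exp.comp ((comap_measurable D).const_mul l)).stronglyMeasurable hind
  have hsplit : (fun ω => Real.exp (l * B ((k + 1 : ℕ) * δ) ω))
      = (fun ω => Real.exp (l * B (k * δ) ω)) * fun ω => Real.exp (l * D ω) := by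
    ext ω
    simp only [Pi.mul_apply, D, ← Real.exp_add]
    rw [show ((k + 1 : ℕ) : ℝ≥0) * δ = k * δ + δ by push_cast; ring]
    ring_nf
  have hpull := condExp_mul_of_stronglyMeasurable_left (μ := P) (hadp k)
    (g := fun ω => Real.exp (l * D ω)) (hsplit ▸ hB.integrable_exp_mul l _) hDint
  rw [hsplit]
  filter_upwards [hcond, hpull] with ω h1 h2
  rw [h2, Pi.mul_apply, h1]
  exact le_mul_of_one_le_right (Real.exp_pos _).le (Real.one_le_exp (by positivity))

/-- Doob's inequality for `exp (a B / T)`, the multiplier `a / T` being the optimal one. -/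
lemma ProbabilityTheory.IsPreBrownianReal.measure_exists_grid_le [IsProbabilityMeasure P]
    (hB : IsPreBrownianReal B P) {T : ℝ≥0} (hT : 0 < T) {a : ℝ} (ha : 0 ≤ a) {n : ℕ} (hn : 0 < n) :
    P {ω | ∃ k : ℕ, k ≤ n ∧ a ≤ B (k * (T / n)) ω}
      ≤ ENNReal.ofReal (Real.exp (-a ^ 2 / (2 * T))) := by
  -- Measurable modifications of the `B t` are needed to generate a filtration.
  wlog hm : ∀ t, Measurable (B t) generalizing B
  · let C : ℝ≥0 → Ω → ℝ := fun t => (hB.aemeasurable t).mk (B t)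
    have hBC : ∀ t, B t =ᵐ[P] C t := fun t => (hB.aemeasurable t).ae_eq_mk
    refine le_trans (measure_mono_ae ?_)
      (this (hB.congr hBC) fun t => (hB.aemeasurable t).measurable_mk)
    filter_upwards [ae_all_iff.2 fun k : ℕ => hBC (k * (T / n))] with ω hω
    rintro ⟨k, hk, h⟩
    exact ⟨k, hk, (hω k) ▸ h⟩
  set l : ℝ := a / T
  have hl : 0 ≤ l := by positivity
  have hsub := hB.submartingale_exp_mul hm l (T / n)
  have hdoob := maximal_ineq hsub (fun k ω => (Real.exp_pos _).le)
    (ε := (Real.exp (l * a)).toNNReal) n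
  set S := {ω | ∃ k : ℕ, k ≤ n ∧ a ≤ B (k * (T / n)) ω}
  set S' := {ω | ((Real.exp (l * a)).toNNReal : ℝ) ≤
    (Finset.range (n + 1)).sup' Finset.nonempty_range_add_one
      fun k => Real.exp (l * B (k * (T / n)) ω)}
  have hSS : S ⊆ S' := by
    rintro ω ⟨k, hk, h⟩
    change (_ : ℝ) ≤ Finset.sup' _ _ _
    refine (Finset.le_sup'_iff _).2 ⟨k, Finset.mem_range.2 (Nat.lt_succ_of_le hk), ?_⟩
    rw [Real.coe_toNNReal _ (Real.exp_pos _).le]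
    exact Real.exp_le_exp.2 (by gcongr)
  have hend : (n : ℝ≥0) * (T / n) = T := by field_simp
  have hint : ∫ ω in S', Real.exp (l * B (n * (T / n)) ω) ∂P ≤ Real.exp (T * l ^ 2 / 2) := by
    rw [← hB.integral_exp_mul l T, hend]
    exact setIntegral_le_integral (hB.integrable_exp_mul l T)
      (Eventually.of_forall fun ω => (Real.exp_pos _).le)
  have hbound : P S' * ENNReal.ofReal (Real.exp (l * a))
      ≤ ENNReal.ofReal (Real.exp (T * l ^ 2 / 2)) := by
    rw [mul_comm]
    exact hdoob.trans (ENNReal.ofReal_le_ofReal hint)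
  have hT' : (0 : ℝ) < T := hT
  calc P S ≤ P S' := measure_mono hSS
    _ ≤ ENNReal.ofReal (Real.exp (T * l ^ 2 / 2)) / ENNReal.ofReal (Real.exp (l * a)) :=
        (ENNReal.le_div_iff_mul_le (Or.inl (by simp [Real.exp_pos])) (Or.inl (by simp))).2 hbound
    _ = ENNReal.ofReal (Real.exp (-a ^ 2 / (2 * T))) := by
        rw [← ENNReal.ofReal_div_of_pos (Real.exp_pos _), ← Real.exp_sub]
        congr 2
        simp only [l]
        field_simp
        ring

/-- The passage to continuous time: by continuity of the paths, a path that exceeds `a` by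
time `T` also reaches `a` at a point of some dyadic grid, and these events increase with the
fineness of the grid. -/
lemma ProbabilityTheory.IsBrownianReal.measure_exists_lt_le [IsProbabilityMeasure P]
    (hB : IsBrownianReal B P) {T : ℝ≥0} (hT : 0 < T) {a : ℝ} (ha : 0 ≤ a) :
    P {ω | ∃ s ≤ T, a < B s ω} ≤ ENNReal.ofReal (Real.exp (-a ^ 2 / (2 * T))) := by
  let S : ℕ → Set Ω := fun n => {ω | ∃ k : ℕ, k ≤ 2 ^ n ∧ a ≤ B (k * (T / (2 ^ n : ℕ))) ω}
  have hmono : Monotone S := by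
    refine monotone_nat_of_le_succ fun n => ?_
    rintro ω ⟨k, hk, h⟩
    refine ⟨2 * k, by rw [pow_succ]; omega, ?_⟩
    rwa [show ((2 * k : ℕ) : ℝ≥0) * (T / (2 ^ (n + 1) : ℕ)) = k * (T / (2 ^ n : ℕ)) by
      push_cast; rw [pow_succ]; field_simp]
  calc P {ω | ∃ s ≤ T, a < B s ω} ≤ P (⋃ n, S n) := by
        refine measure_mono_ae ?_
        filter_upwards [hB.cont] with ω hω
        rintro ⟨s, hs, has⟩
        -- Dyadic approximation of `s / T` from below.
        have hlim : Tendsto (fun n : ℕ =>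
            (⌊(s / T : ℝ) * 2 ^ n⌋₊ : ℝ≥0) * (T / (2 ^ n : ℕ))) atTop (𝓝 s) := by
          rw [← NNReal.tendsto_coe]
          have h := ((tendsto_nat_floor_mul_div_atTop (R := ℝ) (a := s / T) (by positivity)).comp
            (tendsto_pow_atTop_atTop_of_one_lt one_lt_two)).mul_const (T : ℝ)
          rw [div_mul_cancel₀ _ (NNReal.coe_ne_zero.2 hT.ne')] at h
          refine h.congr fun n => ?_
          simp only [Function.comp_apply]
          push_cast
          ring
        obtain ⟨n, hn⟩ := (((hω.tendsto s).comp hlim).eventually (lt_mem_nhds has)).exists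
        refine Set.mem_iUnion.2 ⟨n, _, ?_, hn.le⟩
        refine Nat.floor_le_of_le ?_
        push_cast
        exact mul_le_of_le_one_left (by positivity) (div_le_one_of_le₀ hs T.coe_nonneg)
    _ = ⨆ n, P (S n) := hmono.measure_iUnion
    _ ≤ _ := iSup_le fun n =>
        hB.toIsPreBrownianReal.measure_exists_grid_le hT ha (Nat.two_pow_pos n)

lemma ProbabilityTheory.IsBrownianReal.measure_exists_lt_abs_le [IsProbabilityMeasure P]
    (hB : IsBrownianReal B P) {T : ℝ≥0} (hT : 0 < T) {a : ℝ} (ha : 0 ≤ a) :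
    P {ω | ∃ s ≤ T, a < |B s ω|} ≤ ENNReal.ofReal (2 * Real.exp (-a ^ 2 / (2 * T))) := by
  have hsub : {ω | ∃ s ≤ T, a < |B s ω|} ⊆
      {ω | ∃ s ≤ T, a < B s ω} ∪ {ω | ∃ s ≤ T, a < (-B) s ω} := by
    rintro ω ⟨s, hs, h⟩
    exact (lt_abs.1 h).imp (fun h => ⟨s, hs, h⟩) fun h => ⟨s, hs, h⟩
  rw [two_mul, ENNReal.ofReal_add (Real.exp_pos _).le (Real.exp_pos _).le]
  exact (measure_mono hsub).trans ((measure_union_le _ _).trans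
    (add_le_add (hB.measure_exists_lt_le hT ha) (hB.neg.measure_exists_lt_le hT ha)))

end Maximal

/-! ### From a mesh of starting points to the whole unit interval -/

section Interpolation

variable {Ω : Type*} {mΩ : MeasurableSpace Ω} {P : Measure Ω} {X : ℝ → ℝ≥0 → Ω → ℝ}

/-- If a nondecreasing function moves each point `k h` of the mesh covering `[0, 1]` by at most
`a`, then it moves every point of `[0, 1]` by at most `a + h`. -/
lemma Monotone.abs_sub_le_of_mesh {f : ℝ → ℝ} (hf : Monotone f) {h a : ℝ} (hh : 0 < h)
    (hmesh : ∀ k < ⌈h⁻¹⌉₊ + 2, |f (k * h) - k * h| ≤ a) {u : ℝ} (hu : u ∈ Set.Icc (0 : ℝ) 1) :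
    |f u - u| ≤ a + h := by
  set k := ⌊u / h⌋₊
  have hk1 : (k : ℝ) * h ≤ u := (le_div_iff₀ hh).1 (Nat.floor_le (div_nonneg hu.1 hh.le))
  have hk2 : u ≤ ((k + 1 : ℕ) : ℝ) * h := by
    push_cast
    exact ((div_lt_iff₀ hh).1 (Nat.lt_floor_add_one _)).le
  have hkN : k ≤ ⌈h⁻¹⌉₊ := by
    refine (Nat.floor_le_ceil _).trans (Nat.ceil_le_ceil ?_)
    rw [div_eq_mul_inv]
    exact mul_le_of_le_one_left (by positivity) hu.2
  have h1 := abs_le.1 (hmesh k (by omega))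
  have h2 := abs_le.1 (hmesh (k + 1) (by omega))
  have h3 := hf hk1
  have h4 := hf hk2
  push_cast at h2 h4 hk2
  exact abs_le.2 ⟨by linarith, by linarith⟩

/-- The union bound over the mesh `{k h}` covering `[0, 1]`, combined with the maximal inequality
for each of the Brownian motions started there. -/
lemma IsMonotoneBrownianFamily.measure_exists_mesh_le [IsProbabilityMeasure P]
    (hX : IsMonotoneBrownianFamily X P) {T : ℝ≥0} (hT : 0 < T) {h a : ℝ} (hh : 0 < h) (hh1 : h ≤ 1)
    (ha : 0 ≤ a) :
    P {ω | ∃ k < ⌈h⁻¹⌉₊ + 2, ∃ s ≤ T, a < |X (k * h) s ω - k * h|}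
      ≤ ENNReal.ofReal (8 * h⁻¹ * Real.exp (-a ^ 2 / (2 * T))) := by
  set N := ⌈h⁻¹⌉₊ + 2
  have hN : (N : ℝ) ≤ 4 * h⁻¹ := by
    have h1 : (1 : ℝ) ≤ h⁻¹ := (one_le_inv₀ hh).2 hh1
    have h2 := Nat.ceil_lt_add_one (a := h⁻¹) (by positivity)
    simp only [N]
    push_cast
    linarith
  have hsub : {ω | ∃ k < N, ∃ s ≤ T, a < |X (k * h) s ω - k * h|} ⊆
      ⋃ k ∈ Finset.range N, {ω | ∃ s ≤ T, a < |X (k * h) s ω - k * h|} := by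
    rintro ω ⟨k, hk, hω⟩
    exact Set.mem_biUnion (Finset.mem_coe.2 (Finset.mem_range.2 hk)) hω
  calc _ ≤ ∑ k ∈ Finset.range N, P {ω | ∃ s ≤ T, a < |X (k * h) s ω - k * h|} :=
        (measure_mono hsub).trans (measure_biUnion_finset_le _ _)
    _ ≤ ∑ k ∈ Finset.range N, ENNReal.ofReal (2 * Real.exp (-a ^ 2 / (2 * T))) :=
        Finset.sum_le_sum fun k _ => (hX.brownian _).measure_exists_lt_abs_le hT ha
    _ = ENNReal.ofReal (N * (2 * Real.exp (-a ^ 2 / (2 * T)))) := by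
        rw [Finset.sum_const, Finset.card_range, ← ENNReal.ofReal_nsmul, nsmul_eq_mul]
    _ ≤ _ := by
        refine ENNReal.ofReal_le_ofReal ?_
        have := Real.exp_pos (-a ^ 2 / (2 * T))
        nlinarith

/-- Borel–Cantelli along the times `exp (-2 n ℓ)` with mesh `exp (-n ℓ)`. The probabilities are at
most `8 exp (n ℓ) exp (-c² n ℓ)`, so every constant `c > 1` makes them summable. -/
lemma IsMonotoneBrownianFamily.ae_eventually_forall_mesh_le [IsProbabilityMeasure P]
    (hX : IsMonotoneBrownianFamily X P) {c ℓ : ℝ} (hc : 1 < c) (hℓ : 0 < ℓ) :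
    ∀ᵐ ω ∂P, ∀ᶠ n : ℕ in atTop, ∀ k < ⌈(Real.exp (-(n * ℓ)))⁻¹⌉₊ + 2,
      ∀ s ≤ (Real.exp (-(2 * (n * ℓ)))).toNNReal,
        |X (k * Real.exp (-(n * ℓ))) s ω - k * Real.exp (-(n * ℓ))|
          ≤ c * Real.sqrt (Real.exp (-(2 * (n * ℓ))) * (2 * (n * ℓ))) := by
  let h : ℕ → ℝ := fun n => Real.exp (-(n * ℓ))
  let T : ℕ → ℝ := fun n => Real.exp (-(2 * (n * ℓ)))
  let a : ℕ → ℝ := fun n => c * Real.sqrt (T n * (2 * (n * ℓ)))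
  let S : ℕ → Set Ω := fun n =>
    {ω | ∃ k < ⌈(h n)⁻¹⌉₊ + 2, ∃ s ≤ (T n).toNNReal, a n < |X (k * h n) s ω - k * h n|}
  have hS : ∀ n, P (S n) ≤ ENNReal.ofReal (8 * Real.exp (n * (-(ℓ * (c ^ 2 - 1))))) := by
    intro n
    have hTn : 0 < T n := Real.exp_pos _
    refine (hX.measure_exists_mesh_le (Real.toNNReal_pos.2 hTn) (Real.exp_pos _)
      (Real.exp_le_one_iff.2 (neg_nonpos.2 (by positivity))) (by positivity)).trans_eq ?_
    rw [Real.coe_toNNReal _ hTn.le, mul_pow, Real.sq_sqrt (by positivity), mul_assoc,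
      ← Real.exp_neg, ← Real.exp_add]
    congr 3
    field_simp
    ring
  have hsum : Summable fun n : ℕ => 8 * Real.exp (n * (-(ℓ * (c ^ 2 - 1)))) := by
    refine (Real.summable_exp_nat_mul_iff.2 (neg_neg_iff_pos.2 (mul_pos hℓ ?_))).mul_left 8
    nlinarith
  have hfin : ∑' n, P (S n) ≠ ∞ := by
    refine ne_top_of_le_ne_top ?_ (ENNReal.tsum_le_tsum hS)
    rw [← ENNReal.ofReal_tsum_of_nonneg (fun n => by positivity) hsum]
    exact ENNReal.ofReal_ne_top
  filter_upwards [ae_eventually_notMem hfin] with ω hω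
  filter_upwards [hω] with n hn k hk s hs
  by_contra hcon
  exact hn ⟨k, hk, s, hs, not_le.1 hcon⟩

/-- The upper bound along a geometric sequence of times of ratio `c⁻²`. One factor `c` comes from
the level of the Borel–Cantelli estimate, one absorbs the mesh size, and one accounts for the times
between consecutive members of the sequence. -/
lemma IsMonotoneBrownianFamily.ae_limsup_le_pow_three [IsProbabilityMeasure P]
    (hX : IsMonotoneBrownianFamily X P) {c : ℝ} (hc : 1 < c) :
    ∀ᵐ ω ∂P, limsup (fun t : ℝ≥0 => normalizedSupDeviation X t ω) (𝓝[>] 0)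
      ≤ ENNReal.ofReal (c ^ 3) := by
  set ℓ := Real.log c
  have hℓ : 0 < ℓ := Real.log_pos hc
  have hexp : Real.exp ℓ = c := Real.exp_log (by linarith)
  filter_upwards [hX.ae_eventually_forall_mesh_le hc hℓ, hX.monotone] with ω hω hmon
  have hlog : Tendsto (fun t : ℝ≥0 => Real.log (t : ℝ)⁻¹ / (2 * ℓ)) (𝓝[>] 0) atTop := by
    have h0 : Tendsto (fun t : ℝ≥0 => (t : ℝ)) (𝓝[>] 0) (𝓝[>] 0) := by
      refine tendsto_nhdsWithin_iff.2 ⟨?_, ?_⟩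
      · exact (NNReal.continuous_coe.tendsto 0).mono_left nhdsWithin_le_nhds
      · filter_upwards [self_mem_nhdsWithin] with t ht using NNReal.coe_pos.2 ht
    exact (Real.tendsto_log_atTop.comp (tendsto_inv_nhdsGT_zero.comp h0)).atTop_div_const
      (by positivity)
  have hfloor := tendsto_nat_floor_atTop.comp hlog
  -- From this rank on, the mesh size is at most `(c² - c) √(Tₙ log Tₙ⁻¹)`.
  have hmesh : ∀ᶠ n : ℕ in atTop, 1 ≤ (c ^ 2 - c) * Real.sqrt (2 * (n * ℓ)) := by
    refine Tendsto.eventually_ge_atTop ?_ 1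
    refine Tendsto.const_mul_atTop (by nlinarith) (Real.tendsto_sqrt_atTop.comp ?_)
    exact (tendsto_natCast_atTop_atTop.atTop_mul_const hℓ).const_mul_atTop two_pos
  refine limsup_le_of_le (by isBoundedDefault) ?_
  filter_upwards [hfloor.eventually hω, hfloor.eventually hmesh, hlog.eventually_ge_atTop 0,
    self_mem_nhdsWithin] with t ht hm hlog0 htpos
  have htpos' : (0 : ℝ) < t := htpos
  simp only [Function.comp_apply] at ht hm
  set n := ⌊Real.log (t : ℝ)⁻¹ / (2 * ℓ)⌋₊
  -- The integer `n` satisfies `exp (-2 (n + 1) ℓ) < t ≤ exp (-2 n ℓ)`.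
  set L := Real.log (t : ℝ)⁻¹
  have htL : (t : ℝ) = Real.exp (-L) := by
    rw [show L = -Real.log t from Real.log_inv _, neg_neg, Real.exp_log htpos']
  have hn1 : 2 * (n * ℓ) ≤ L := by
    have := (le_div_iff₀ (by positivity)).1 (Nat.floor_le hlog0)
    linarith
  have hn2 : L ≤ 2 * (n * ℓ) + 2 * ℓ := by
    have := (div_lt_iff₀ (by positivity)).1 (Nat.lt_floor_add_one (L / (2 * ℓ)))
    linarith
  set Q := Real.sqrt (Real.exp (-(2 * (n * ℓ))) * (2 * (n * ℓ)))
  have hhQ : Real.exp (-(n * ℓ)) ≤ (c ^ 2 - c) * Q := by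
    have hQ : Q = Real.exp (-(n * ℓ)) * Real.sqrt (2 * (n * ℓ)) := by
      simp only [Q]
      rw [Real.sqrt_mul (Real.exp_pos _).le,
        show -(2 * (n * ℓ)) = -(n * ℓ) + -(n * ℓ) by ring, Real.exp_add,
        Real.sqrt_mul_self (Real.exp_pos _).le]
    rw [hQ]
    have := mul_le_mul_of_nonneg_left hm (Real.exp_pos (-(n * ℓ))).le
    linarith
  have hQt : Q ≤ c * Real.sqrt (t * L) := by
    rw [← Real.sqrt_sq (by linarith : 0 ≤ c), ← Real.sqrt_mul (sq_nonneg c)]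
    refine Real.sqrt_le_sqrt ?_
    have h1 : Real.exp (-(2 * (n * ℓ))) ≤ c ^ 2 * t := by
      rw [htL, ← hexp, ← Real.exp_nat_mul, ← Real.exp_add]
      refine Real.exp_le_exp.2 ?_
      push_cast
      linarith
    exact (mul_le_mul h1 hn1 (by positivity) (by positivity)).trans_eq (mul_assoc _ _ _)
  have htT : t ≤ (Real.exp (-(2 * (n * ℓ)))).toNNReal := by
    rw [← NNReal.coe_le_coe, Real.coe_toNNReal _ (Real.exp_pos _).le, htL]
    exact Real.exp_le_exp.2 (by linarith)
  refine iSup₂_le fun u hu => ENNReal.ofReal_le_ofReal ?_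
  refine div_le_of_le_mul₀ (Real.sqrt_nonneg _) (by positivity) ?_
  have hdev := (hmon t).abs_sub_le_of_mesh (Real.exp_pos _) (fun k hk => ht k hk t htT) hu
  calc |X u t ω - u| ≤ c * Q + Real.exp (-(n * ℓ)) := hdev
    _ ≤ c ^ 2 * Q := by linarith
    _ ≤ c ^ 2 * (c * Real.sqrt (t * L)) := by gcongr
    _ = c ^ 3 * Real.sqrt (t * L) := by ring

lemma IsMonotoneBrownianFamily.ae_limsup_le_one [IsProbabilityMeasure P]
    (hX : IsMonotoneBrownianFamily X P) :
    ∀ᵐ ω ∂P, limsup (fun t : ℝ≥0 => normalizedSupDeviation X t ω) (𝓝[>] 0) ≤ 1 := by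
  have hlim : Tendsto (fun n : ℕ => ENNReal.ofReal ((1 + 1 / ((n : ℝ) + 1)) ^ 3)) atTop (𝓝 1) := by
    have h := ((tendsto_one_div_add_atTop_nhds_zero_nat (𝕜 := ℝ)).const_add 1).pow 3
    simpa using ENNReal.tendsto_ofReal h
  have hall := ae_all_iff.2 fun n : ℕ =>
    hX.ae_limsup_le_pow_three (c := 1 + 1 / ((n : ℝ) + 1)) (lt_add_of_pos_right _ (by positivity))
  filter_upwards [hall] with ω hω
  exact ge_of_tendsto' hlim hω

end Interpolation

theorem theorem3p1 {Ω : Type*} {mΩ : MeasurableSpace Ω} (P : Measure Ω) [IsProbabilityMeasure P]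
    (X : ℝ → ℝ≥0 → Ω → ℝ) :
    (IsMonotoneBrownianFamily X P →
      ∀ᵐ ω ∂P, limsup (fun t : ℝ≥0 => normalizedSupDeviation X t ω) (𝓝[>] 0) ≤ 1) ∧
    (∀ (φ : ℝ → ℝ) (𝓕 : Filtration ℝ≥0 mΩ), φ 0 = 1 → IsHarrisFlow φ X 𝓕 P →
      ∀ᵐ ω ∂P, limsup (fun t : ℝ≥0 => normalizedSupDeviation X t ω) (𝓝[>] 0) ≤ 1) :=
  ⟨fun hX => hX.ae_limsup_le_one,
    fun _ _ _ hX => hX.toIsMonotoneBrownianFamily.ae_limsup_le_one⟩
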